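/- Let $\mathbb K$ be a field of characteristic $0$. Let $\mathcal F_1$ be the group, under composition, of all formal power series $g = g_1x+g_2x^2+\cdots\in\mathbb K[[x]]$ with $g_1\neq 0$, and let $\mathcal J\le\mathcal F_1$ be the substitution group, that is, the subgroup of all series of the form $x+g_2x^2+g_3x^3+\cdots$. For a group $G$ put $G^{(0)}=G$ and, for $n\ge 1$, let $G^{(n)}=[G^{(n-1)},G^{(n-1)}]$ be the subgroup generated by all commutators $[a,b]=a^{-1}b^{-1}ab$ with $a,b\in G^{(n-1)}$. Then for every integer $n\ge 1$ $$\mathcal F_1^{(n)}=\mathcal J^{(n-1)}=\{g\in\mathcal J : g\in x+x^{2^n}\mathbb K[[x]]\},$$ and every element of this group is a commutator $[a,b]$ of two elements $a,b\in\mathcal F_1^{(n-1)}$. -/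

import Mathlib

open PowerSeries

noncomputable section

/-- The set `𝓕₁` of formal power series of order one over `K`: all series
`g₁ x + g₂ x² + ⋯` with `g₁ ≠ 0`. -/
@[ext]
structure F1 (K : Type*) [Field K] where
  /-- the underlying power series -/
  series : PowerSeries K
  constantCoeff_eq_zero : constantCoeff series = 0
  coeff_one_ne_zero : coeff 1 series ≠ 0

namespace F1

variable {K : Type*} [Field K]

theorem hasSubst (f : F1 K) : HasSubst f.series :=
  HasSubst.of_constantCoeff_zero' f.constantCoeff_eq_zero

theorem constantCoeff_subst_eq_zero (f g : F1 K) :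
    constantCoeff (f.series.subst g.series : PowerSeries K) = 0 :=
  PowerSeries.constantCoeff_subst_eq_zero g.constantCoeff_eq_zero f.series
    f.constantCoeff_eq_zero

theorem coeff_one_subst (f g : F1 K) :
    coeff 1 (f.series.subst g.series : PowerSeries K) =
      coeff 1 f.series * coeff 1 g.series := by
  rw [coeff_subst' g.hasSubst, finsum_eq_single (a := 1)]
  · simp
  · obtain ⟨q, hq⟩ := X_dvd_iff.mpr g.constantCoeff_eq_zero
    rintro (_ | _ | n) hn
    · simp [coeff_one]
    · exact absurd rfl hn
    · simp [hq, mul_pow, coeff_X_pow_mul']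

/-- The group structure on `𝓕₁` given by composition: `f * g` is the series `f(g(x))`, the
neutral element is `x`, and `f⁻¹` is the compositional inverse. -/
instance : Group (F1 K) where
  mul f g :=
    { series := f.series.subst g.series
      constantCoeff_eq_zero := constantCoeff_subst_eq_zero f g
      coeff_one_ne_zero := by
        rw [coeff_one_subst]
        exact mul_ne_zero f.coeff_one_ne_zero g.coeff_one_ne_zero }
  one :=
    { series := X
      constantCoeff_eq_zero := constantCoeff_X
      coeff_one_ne_zero := by simp }
  inv f :=
    { series := f.series.substInvOfIsUnit f.coeff_one_ne_zero.isUnit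
      constantCoeff_eq_zero := constantCoeff_substInvOfIsUnit _ _
      coeff_one_ne_zero := by
        rw [coeff_one_substInvOfIsUnit]
        exact Units.ne_zero _ }
  mul_assoc f g h := F1.ext (subst_comp_subst_apply g.hasSubst h.hasSubst f.series)
  one_mul f := F1.ext (subst_X f.hasSubst)
  mul_one f := F1.ext (X_subst f.series)
  inv_mul_cancel f := F1.ext
    (subst_substInvOfIsUnit_left f.series f.constantCoeff_eq_zero f.coeff_one_ne_zero.isUnit)

theorem series_mul (f g : F1 K) : (f * g).series = f.series.subst g.series := rfl

theorem series_one : (1 : F1 K).series = X := rfl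

theorem coeff_one_mul (f g : F1 K) :
    coeff 1 (f * g).series = coeff 1 f.series * coeff 1 g.series :=
  coeff_one_subst f g

/-- The substitution group `𝓙`: the subgroup of `𝓕₁` of all series `x + g₂ x² + ⋯`. -/
def J (K : Type*) [Field K] : Subgroup (F1 K) where
  carrier := {g | coeff 1 g.series = 1}
  mul_mem' {f g} hf hg := by
    simp only [Set.mem_ofPred_eq] at hf hg ⊢
    rw [coeff_one_mul, hf, hg, one_mul]
  one_mem' := by simp [series_one]
  inv_mem' {f} hf := by
    simp only [Set.mem_ofPred_eq] at hf ⊢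
    have h := coeff_one_mul f⁻¹ f
    rw [inv_mul_cancel, hf, mul_one] at h
    simpa [series_one] using h.symm

end F1

end

/-! ### Congruences modulo powers of `X` under substitution -/

namespace PowerSeries

variable {K : Type*} [Field K]

/-! Filter the group by the subgroups `depth K N`: depth 0 is everything, depth 1 is `J`. The key is
`commutator_depth`: commutators of depth `m` generate depth `2 * m + 1`, and iterating this from 0
gives `2 ^ n - 1`. Upper bound: for `m, k ≥ 1`, `f ∘ h - h ∘ f` starts with `(m - k) f_{m+1} h_{k+1}
x^(m+k+1)`, which vanishes for `k = m`. Lower bound: in characteristic 0 the factor is nonzero for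
`k > m`, so one fixed `a` of depth `m` realises every leading term in degree `m + k + 1`
(`exists_comm_leading`; for `m = 0`, `a = 2x` plays this role). A target is then matched degree by
degree (`exists_comm_approx`) and the corrections converge `X`-adically, so one commutator suffices.
-/

theorem X_pow_dvd_subst {h : PowerSeries K} (hh : constantCoeff h = 0) {N : ℕ}
    {p : PowerSeries K} (hp : X ^ N ∣ p) : X ^ N ∣ (p.subst h : PowerSeries K) := by
  obtain ⟨q, rfl⟩ := hp
  have hs : HasSubst h := HasSubst.of_constantCoeff_zero' hh
  rw [subst_mul hs, subst_pow hs, subst_X hs]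
  exact (pow_dvd_pow_of_dvd (X_dvd_iff.mpr hh) N).mul_right _

/-- Substitution respects congruences modulo `X ^ N` in the outer series. -/
theorem X_pow_dvd_subst_sub_left {h : PowerSeries K} (hh : constantCoeff h = 0) {N : ℕ}
    {p q : PowerSeries K} (hp : X ^ N ∣ p - q) :
    X ^ N ∣ (p.subst h : PowerSeries K) - q.subst h := by
  have hs : HasSubst h := HasSubst.of_constantCoeff_zero' hh
  have := X_pow_dvd_subst hh hp
  rwa [← coe_substAlgHom hs, map_sub, coe_substAlgHom hs] at this

/-- Substitution respects congruences modulo `X ^ N` in the inner series. -/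
theorem X_pow_dvd_subst_sub_right {h k : PowerSeries K} (hh : constantCoeff h = 0)
    (hk : constantCoeff k = 0) {N : ℕ} (hd : X ^ N ∣ h - k) (p : PowerSeries K) :
    X ^ N ∣ (p.subst h : PowerSeries K) - p.subst k := by
  -- Truncation reduces to polynomials, where `h - k` divides `p(h) - p(k)`.
  have ht : X ^ N ∣ p - (trunc N p : PowerSeries K) := by
    rw [X_pow_dvd_iff]
    intro m hm
    simp [coeff_trunc, hm]
  have h1 := X_pow_dvd_subst_sub_left hh ht
  have h2 := X_pow_dvd_subst_sub_left hk ht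
  rw [subst_coe (HasSubst.of_constantCoeff_zero' hh)] at h1
  rw [subst_coe (HasSubst.of_constantCoeff_zero' hk)] at h2
  have h3 : X ^ N ∣ Polynomial.aeval h (trunc N p) - Polynomial.aeval k (trunc N p) := by
    rw [← Polynomial.eval_map_algebraMap, ← Polynomial.eval_map_algebraMap]
    exact hd.trans (Polynomial.sub_dvd_eval_sub _ _ _)
  convert dvd_sub (dvd_add h1 h3) h2 using 1
  ring

end PowerSeries

/-! ### The depth filtration -/

namespace F1

variable {K : Type*} [Field K]

/-- Congruence modulo `X ^ N` of the underlying series. -/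
def Cong (N : ℕ) (f g : F1 K) : Prop := X ^ N ∣ f.series - g.series

namespace Cong

variable {N M : ℕ} {f g h k : F1 K}

theorem refl (N : ℕ) (f : F1 K) : Cong N f f := by simp [Cong]

theorem symm (H : Cong N f g) : Cong N g f := by
  rw [Cong, ← neg_sub]
  exact (dvd_neg).mpr H

theorem trans (H : Cong N f g) (H' : Cong N g h) : Cong N f h := by
  have := dvd_add H H'
  rwa [sub_add_sub_cancel] at this

theorem mono (hNM : N ≤ M) (H : Cong M f g) : Cong N f g :=
  (pow_dvd_pow _ hNM).trans H

theorem mul (H : Cong N f g) (H' : Cong N h k) : Cong N (f * h) (g * k) := by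
  have h1 := X_pow_dvd_subst_sub_left h.constantCoeff_eq_zero H
  have h2 := X_pow_dvd_subst_sub_right h.constantCoeff_eq_zero k.constantCoeff_eq_zero H' g.series
  have := dvd_add h1 h2
  rwa [sub_add_sub_cancel] at this

theorem inv (H : Cong N f g) : Cong N f⁻¹ g⁻¹ := by
  have := ((refl N f⁻¹).mul H.symm).mul (refl N g⁻¹)
  rwa [mul_assoc, mul_inv_cancel, mul_one, inv_mul_cancel, one_mul] at this

theorem coeff_eq (H : Cong N f g) {j : ℕ} (hj : j < N) :
    coeff j f.series = coeff j g.series := by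
  have := X_pow_dvd_iff.mp H j hj
  rwa [map_sub, sub_eq_zero] at this

theorem eq_of_forall (H : ∀ N, Cong N f g) : f = g :=
  F1.ext (PowerSeries.ext fun j => (H (j + 1)).coeff_eq j.lt_succ_self)

end Cong

/-- The subgroup of series congruent to `x` modulo `x ^ (N + 1)`. -/
def depth (K : Type*) [Field K] (N : ℕ) : Subgroup (F1 K) where
  carrier := {g | Cong (N + 1) g 1}
  mul_mem' hf hg := by
    have := Cong.mul hf hg
    rwa [mul_one] at this
  one_mem' := Cong.refl _ _
  inv_mem' hf := by
    have := Cong.inv hf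
    rwa [inv_one] at this

theorem mem_depth {N : ℕ} {g : F1 K} : g ∈ depth K N ↔ Cong (N + 1) g 1 := Iff.rfl

theorem depth_anti {N M : ℕ} (h : N ≤ M) : depth K M ≤ depth K N :=
  fun _ hg => Cong.mono (by omega) hg

theorem mem_depth_iff_exists {N : ℕ} {g : F1 K} :
    g ∈ depth K N ↔ ∃ u : PowerSeries K, g.series = X + X ^ (N + 1) * u := by
  simp only [mem_depth, Cong, series_one, dvd_def, sub_eq_iff_eq_add']

theorem depth_zero : depth K 0 = ⊤ := by
  rw [eq_top_iff]
  intro g _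
  rw [mem_depth, Cong, zero_add, pow_one, X_dvd_iff]
  simp [g.constantCoeff_eq_zero, series_one]

theorem depth_one : depth K 1 = J K := by
  ext g
  change X ^ 2 ∣ g.series - X ↔ coeff 1 g.series = 1
  rw [X_pow_dvd_iff]
  constructor
  · intro h
    simpa [sub_eq_zero] using h 1 one_lt_two
  · intro h m hm
    interval_cases m
    · simp [g.constantCoeff_eq_zero]
    · simp [h]

theorem inv_mul_mem_depth_of_cong {N : ℕ} {f g : F1 K} (H : Cong (N + 1) f g) :
    g⁻¹ * f ∈ depth K N := by
  have := (Cong.refl _ g⁻¹).mul H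
  rwa [inv_mul_cancel] at this

/-! ### Leading terms of compositions -/

/-- First-order expansion of `y ∘ t` for `t` close to `x`. -/
theorem X_pow_dvd_series_mul_sub {N : ℕ} (y : F1 K) {t : F1 K}
    (ht : t ∈ depth K N) :
    X ^ (N + 2) ∣ (y * t).series - y.series - C (coeff 1 y.series) * (t.series - X) := by
  obtain ⟨w, hw⟩ := X_dvd_iff.mpr y.constantCoeff_eq_zero
  have hw1 : coeff 1 y.series = constantCoeff w := by
    rw [hw, show (1 : ℕ) = 0 + 1 from rfl, coeff_succ_X_mul, coeff_zero_eq_constantCoeff]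
  have ht' : X ^ (N + 1) ∣ t.series - X := ht
  have hyt : (y * t).series = t.series * w.subst t.series := by
    rw [series_mul, hw, subst_mul t.hasSubst, subst_X t.hasSubst]
  have h1 : X ^ (N + 1) ∣ (w.subst t.series : PowerSeries K) - w := by
    have := X_pow_dvd_subst_sub_right t.constantCoeff_eq_zero constantCoeff_X ht' w
    rwa [← map_algebraMap_eq_subst_X, Algebra.algebraMap_self, map_id, id_eq] at this
  have h2 : X ∣ w - C (constantCoeff w) := by
    rw [X_dvd_iff]
    simp
  have h3 := dvd_add (mul_dvd_mul h1 (X_dvd_iff.mpr t.constantCoeff_eq_zero))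
    (mul_dvd_mul ht' h2)
  rw [hyt, hw1, hw]
  convert h3 using 1 <;> ring

theorem X_pow_dvd_one_add_pow_sub {k : ℕ} (n : ℕ) (v : PowerSeries K) :
    X ^ (2 * k) ∣ (1 + X ^ k * v) ^ n - 1 - (n : PowerSeries K) * (X ^ k * v) := by
  rw [pow_mul']
  induction n with
  | zero => simp
  | succ n ih =>
    have := dvd_add (ih.mul_right (1 + X ^ k * v))
      (dvd_mul_right ((X ^ k : PowerSeries K) ^ 2) (n * v ^ 2))
    convert this using 1
    push_cast
    ring

/-- Expansion of the composition of two series of given depths, up to the first term in which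
they interact. -/
theorem X_pow_dvd_comp_sub {m k : ℕ} (hm : 1 ≤ m) (hk : 1 ≤ k) {f h : F1 K} (hf : f ∈ depth K m)
    (hh : h ∈ depth K k) :
    X ^ (m + k + 2) ∣ (f * h).series - (f.series + h.series - X) -
      C ((m + 1) * coeff (m + 1) f.series * coeff (k + 1) h.series) * X ^ (m + k + 1) := by
  obtain ⟨u, hu⟩ := mem_depth_iff_exists.mp hf
  obtain ⟨v, hv⟩ := mem_depth_iff_exists.mp hh
  obtain ⟨l, rfl⟩ := Nat.exists_eq_add_of_le' hk
  have hfh : (f * h).series = h.series + h.series ^ (m + 1) * u.subst h.series := by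
    rw [series_mul, hu, subst_add h.hasSubst, subst_mul h.hasSubst, subst_pow h.hasSubst,
      subst_X h.hasSubst]
  obtain ⟨s, hs⟩ : X ^ (l + 1 + 1) ∣ (u.subst h.series : PowerSeries K) - u := by
    have := X_pow_dvd_subst_sub_right h.constantCoeff_eq_zero constantCoeff_X hh u
    rwa [← map_algebraMap_eq_subst_X, Algebra.algebraMap_self, map_id, id_eq] at this
  obtain ⟨r, hr⟩ := X_pow_dvd_one_add_pow_sub (k := l + 1) (m + 1) v
  obtain ⟨w, hw⟩ : X ∣ u * v - C (constantCoeff u * constantCoeff v) := by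
    rw [X_dvd_iff]
    simp
  have hpow : h.series ^ (m + 1) = X ^ (m + 1) * (1 + X ^ (l + 1) * v) ^ (m + 1) := by
    rw [hv, ← mul_pow]
    ring
  have hcoeff {j : ℕ} (hj : 1 ≤ j) (z : PowerSeries K) :
      coeff (j + 1) (X + X ^ (j + 1) * z) = constantCoeff z := by
    rw [map_add, coeff_X_pow_mul', if_pos le_rfl, Nat.sub_self, coeff_zero_eq_constantCoeff,
      coeff_X, if_neg (by omega), zero_add]
  have hC : C ((m + 1) * coeff (m + 1) f.series * coeff (l + 1 + 1) h.series) =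
      ((m + 1 : ℕ) : PowerSeries K) * C (constantCoeff u * constantCoeff v) := by
    rw [hu, hv, hcoeff hm, hcoeff hk]
    simp [mul_assoc]
  rw [hC, hfh, hpow, eq_add_of_sub_eq' hs, hu, hv]
  refine ⟨(1 + X ^ (l + 1) * v) ^ (m + 1) * s + ((m + 1 : ℕ) : PowerSeries K) * w +
    X ^ l * r * u, ?_⟩
  have hr' : (1 + X ^ (l + 1) * v) ^ (m + 1) = 1 + ((m + 1 : ℕ) : PowerSeries K) *
      (X ^ (l + 1) * v) + X ^ (2 * (l + 1)) * r := by
    rw [← hr]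
    ring
  have hw' : C (constantCoeff u * constantCoeff v) = u * v - X * w := by
    rw [← hw]
    ring
  rw [mul_add _ u, hr', hw']
  ring

/-- Two series of depths `m` and `k` commute modulo `X ^ (m + k + 1)`, and their compositions in
the two orders differ by an explicit multiple of `X ^ (m + k + 1)` to first order. -/
theorem X_pow_dvd_mul_sub_mul {m k : ℕ} (hm : 1 ≤ m) (hk : 1 ≤ k) {f h : F1 K}
    (hf : f ∈ depth K m) (hh : h ∈ depth K k) :
    X ^ (m + k + 2) ∣ (f * h).series - (h * f).series -
      C ((m - k) * coeff (m + 1) f.series * coeff (k + 1) h.series) * X ^ (m + k + 1) := by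
  have h1 := X_pow_dvd_comp_sub hm hk hf hh
  have h2 := X_pow_dvd_comp_sub hk hm hh hf
  rw [add_comm k m] at h2
  convert dvd_sub h1 h2 using 1
  rw [show ((m : K) - k) * coeff (m + 1) f.series * coeff (k + 1) h.series =
    (m + 1) * coeff (m + 1) f.series * coeff (k + 1) h.series -
      (k + 1) * coeff (k + 1) h.series * coeff (m + 1) f.series by ring, map_sub]
  ring

theorem cong_of_X_pow_dvd_sub {N : ℕ} {f g : F1 K} {γ : K}
    (H : X ^ (N + 2) ∣ f.series - g.series - C γ * X ^ (N + 1)) : Cong (N + 1) f g := by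
  have := dvd_add ((pow_dvd_pow X (Nat.le_succ (N + 1))).trans H)
    (dvd_mul_left (X ^ (N + 1)) (C γ))
  rwa [sub_add_cancel] at this

/-- If `y` and `z` differ by `γ X ^ (N + 1)` to first order, so do `z⁻¹ * y` and `x`, up to the
linear coefficient of `z`. -/
theorem X_pow_dvd_inv_mul_sub {N : ℕ} {y z : F1 K} {γ : K}
    (H : X ^ (N + 2) ∣ y.series - z.series - C (coeff 1 z.series * γ) * X ^ (N + 1)) :
    X ^ (N + 2) ∣ (z⁻¹ * y).series - X - C γ * X ^ (N + 1) := by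
  have ht : z⁻¹ * y ∈ depth K N := inv_mul_mem_depth_of_cong (cong_of_X_pow_dvd_sub H)
  have h1 := X_pow_dvd_series_mul_sub z ht
  rw [mul_inv_cancel_left] at h1
  have h2 := (dvd_sub H h1).mul_left (C (coeff 1 z.series)⁻¹)
  have hc : C (coeff 1 z.series)⁻¹ * C (coeff 1 z.series) = (1 : PowerSeries K) := by
    rw [← map_mul, inv_mul_cancel₀ z.coeff_one_ne_zero, map_one]
  convert h2 using 1
  rw [map_mul]
  linear_combination (-((z⁻¹ * y).series - X) + C γ * X ^ (N + 1)) * hc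

/-! ### Commutators and their leading terms -/

/-- The commutator `a⁻¹ b⁻¹ a b`. -/
noncomputable def comm (a b : F1 K) : F1 K := a⁻¹ * b⁻¹ * a * b

theorem comm_eq (a b : F1 K) : comm a b = (b * a)⁻¹ * (a * b) := by
  rw [comm]
  group

/-- Correcting `b` to `e * b` multiplies the commutator by `comm a e`, up to a last factor of higher
depth. -/
theorem comm_mul_right (a b e : F1 K) :
    comm a (e * b) = comm a b * comm a e * comm (comm a e) b := by
  simp only [comm]
  group

theorem Cong.comm_right {N : ℕ} {b c : F1 K} (a : F1 K) (H : Cong N b c) :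
    Cong N (comm a b) (comm a c) :=
  (((Cong.refl N _).mul H.inv).mul (Cong.refl N a)).mul H

theorem comm_mem_depth {m k : ℕ} (hm : 1 ≤ m) (hk : 1 ≤ k) {f h : F1 K} (hf : f ∈ depth K m)
    (hh : h ∈ depth K k) : comm f h ∈ depth K (m + k) := by
  rw [comm_eq]
  exact inv_mul_mem_depth_of_cong (cong_of_X_pow_dvd_sub (X_pow_dvd_mul_sub_mul hm hk hf hh))

/-- One more degree than `comm_mem_depth` is gained because the factor `m - k` vanishes for `k = m`;
at `m = 0` it is gained because linear coefficients commute. -/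
theorem comm_mem_depth_self (m : ℕ) {f h : F1 K} (hf : f ∈ depth K m) (hh : h ∈ depth K m) :
    comm f h ∈ depth K (2 * m + 1) := by
  rcases Nat.eq_zero_or_pos m with rfl | hm
  · rw [depth_one, comm_eq]
    have h1 := coeff_one_mul (h * f) (comm f h)
    rw [comm_eq, mul_inv_cancel_left, coeff_one_mul, coeff_one_mul, mul_comm] at h1
    exact mul_left_cancel₀ (mul_ne_zero h.coeff_one_ne_zero f.coeff_one_ne_zero)
      (h1.symm.trans (mul_one _).symm)
  · have h1 := X_pow_dvd_mul_sub_mul hm hm hf hh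
    rw [sub_self, zero_mul, zero_mul, map_zero, zero_mul, sub_zero, ← two_mul] at h1
    rw [comm_eq]
    exact inv_mul_mem_depth_of_cong h1

/-- The series `x + c x ^ (k + 1)`, for `k ≥ 1`. -/
noncomputable def binom (k : ℕ) (hk : 1 ≤ k) (c : K) : F1 K where
  series := X + X ^ (k + 1) * C c
  constantCoeff_eq_zero := by simp
  coeff_one_ne_zero := by
    rw [map_add, coeff_X_pow_mul', if_neg (by omega)]
    simp

theorem binom_mem_depth {k : ℕ} (hk : 1 ≤ k) (c : K) : binom k hk c ∈ depth K k :=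
  mem_depth_iff_exists.mpr ⟨_, rfl⟩

theorem coeff_binom {k : ℕ} (hk : 1 ≤ k) (c : K) : coeff (k + 1) (binom k hk c).series = c := by
  rw [binom, map_add, coeff_X_pow_mul', if_pos le_rfl, Nat.sub_self, coeff_zero_eq_constantCoeff,
    coeff_X, if_neg (by omega), zero_add, constantCoeff_C]

/-- The linear series `c x`, for `c ≠ 0`. -/
noncomputable def linear (c : K) (hc : c ≠ 0) : F1 K where
  series := c • X
  constantCoeff_eq_zero := by simp
  coeff_one_ne_zero := by simpa using hc

theorem coeff_one_eq_one {k : ℕ} (hk : 1 ≤ k) {f : F1 K} (hf : f ∈ depth K k) :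
    coeff 1 f.series = 1 := by
  have := depth_anti hk hf
  rwa [depth_one] at this

/-- In every depth `m` some series has commutators, with series of depth `k > m`, of arbitrary
leading term in depth `m + k`. -/
theorem exists_comm_leading [CharZero K] (m : ℕ) :
    ∃ a ∈ depth K m, ∀ k, m + 1 ≤ k → ∀ γ : K, ∃ e ∈ depth K k,
      X ^ (m + k + 2) ∣ (comm a e).series - X - C γ * X ^ (m + k + 1) := by
  rcases Nat.eq_zero_or_pos m with rfl | hm
  · refine ⟨linear 2 two_ne_zero, depth_zero (K := K) ▸ Subgroup.mem_top _, fun k hk γ => ?_⟩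
    have hk1 : 1 ≤ k := by omega
    have h2 : (1 : K) - 2 ^ k ≠ 0 := by
      rw [sub_ne_zero]
      exact_mod_cast (Nat.one_lt_two_pow (by omega)).ne
    -- With `a = 2x` and `e = x + c x^(k+1)`, `a ∘ e - e ∘ a` is exactly `2 c (1 - 2^k) x^(k+1)`;
    -- the 2 is the linear coefficient of `e ∘ a`.
    refine ⟨binom k hk1 (γ / (1 - 2 ^ k)), binom_mem_depth hk1 _, ?_⟩
    rw [comm_eq, zero_add]
    apply X_pow_dvd_inv_mul_sub
    rw [coeff_one_mul, coeff_one_eq_one hk1 (binom_mem_depth hk1 _)]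
    apply Dvd.intro 0
    set c := γ / (1 - 2 ^ k) with hc
    have hγ : γ = c * (1 - 2 ^ k) := (div_mul_cancel₀ _ h2).symm
    have hs := (linear (2 : K) two_ne_zero).hasSubst
    have hC : (C c : PowerSeries K) = c • 1 := by rw [smul_eq_C_mul, mul_one]
    have h1 : (linear (2 : K) two_ne_zero * binom k hk1 c).series =
        (2 : K) • (X + X ^ (k + 1) * C c) := by
      rw [series_mul, linear, subst_smul (binom k hk1 c).hasSubst,
        subst_X (binom k hk1 c).hasSubst]
      rfl
    have h3 : (binom k hk1 c * linear (2 : K) two_ne_zero).series =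
        (2 : K) • X + ((2 : K) • X) ^ (k + 1) * C c := by
      rw [series_mul, show (binom k hk1 c).series = X + X ^ (k + 1) * C c from rfl, hC,
        mul_smul_comm, mul_one, subst_add hs, subst_smul hs,
        subst_pow hs, subst_X hs, mul_smul_comm, mul_one]
      rfl
    have h4 : coeff 1 (linear (2 : K) two_ne_zero).series = 2 := by simp [linear]
    rw [h1, h3, h4, hγ]
    simp only [smul_eq_C_mul, map_mul, map_sub, map_pow, map_one]
    ring
  · refine ⟨binom m hm 1, binom_mem_depth hm 1, fun k hk γ => ?_⟩
    have hk1 : 1 ≤ k := by omega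
    have h2 : (m : K) - k ≠ 0 := by
      rw [sub_ne_zero]
      exact_mod_cast (show m < k from hk).ne
    refine ⟨binom k hk1 (γ / (m - k)), binom_mem_depth _ _, ?_⟩
    rw [comm_eq]
    apply X_pow_dvd_inv_mul_sub
    have := X_pow_dvd_mul_sub_mul hm hk1 (binom_mem_depth hm (1 : K))
      (binom_mem_depth hk1 (γ / (m - k)))
    rw [coeff_binom, coeff_binom, mul_one, mul_div_cancel₀ _ h2] at this
    rwa [coeff_one_mul, coeff_one_eq_one hk1 (binom_mem_depth _ _),
      coeff_one_eq_one hm (binom_mem_depth _ _), one_mul, one_mul]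

/-! ### Successive approximation -/

/-- A sequence of series that is Cauchy for the `X`-adic topology has a limit. -/
theorem exists_limit {b : ℕ → F1 K} (hb : ∀ i, Cong (i + 2) (b (i + 1)) (b i)) :
    ∃ c : F1 K, ∀ i, Cong (i + 2) c (b i) := by
  have hij : ∀ i j, i ≤ j → Cong (i + 2) (b j) (b i) := by
    intro i j hij
    induction j, hij using Nat.le_induction with
    | base => exact Cong.refl _ _
    | succ j hj ih => exact ((hb j).mono (by omega)).trans ih
  have hcoeff : ∀ i j, j < i + 2 → coeff j (b j).series = coeff j (b i).series := by
    intro i j hj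
    rcases le_total i j with h | h
    · exact (hij i j h).coeff_eq hj
    · exact ((hij j i h).coeff_eq (by omega)).symm
  refine ⟨⟨PowerSeries.mk fun j => coeff j (b j).series, ?_, ?_⟩, fun i => ?_⟩
  · rw [← coeff_zero_eq_constantCoeff_apply, coeff_mk, coeff_zero_eq_constantCoeff_apply]
    exact (b 0).constantCoeff_eq_zero
  · rw [coeff_mk]
    exact (b 1).coeff_one_ne_zero
  · rw [Cong, X_pow_dvd_iff]
    intro j hj
    rw [map_sub, coeff_mk, hcoeff i j hj, sub_self]

theorem exists_comm_approx {m : ℕ} {a : F1 K}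
    (H : ∀ k, m + 1 ≤ k → ∀ γ : K, ∃ e ∈ depth K k,
      X ^ (m + k + 2) ∣ (comm a e).series - X - C γ * X ^ (m + k + 1))
    {g b : F1 K} (hb : b ∈ depth K (m + 1)) {k : ℕ} (hk : m + 1 ≤ k)
    (hg : Cong (m + k + 1) (comm a b) g) :
    ∃ c ∈ depth K (m + 1), Cong (k + 1) c b ∧ Cong (m + k + 2) (comm a c) g := by
  -- The missing coefficient is divided by the linear coefficient of `comm a b`, since composing
  -- with it on the left rescales the correction.
  obtain ⟨e, he, hγ⟩ := H k hk
    ((coeff 1 (comm a b).series)⁻¹ * coeff (m + k + 1) (g.series - (comm a b).series))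
  have hae : comm a e ∈ depth K (m + k) := cong_of_X_pow_dvd_sub hγ
  refine ⟨e * b, mul_mem (depth_anti hk he) hb, ?_, ?_⟩
  · have := Cong.mul he (Cong.refl (k + 1) b)
    rwa [one_mul] at this
  · rw [comm_mul_right]
    -- Harmless because `b` has depth at least 1.
    have h1 : Cong (m + k + 2) (comm (comm a e) b) 1 :=
      depth_anti (by omega) (comm_mem_depth (by omega) (by omega) hae hb)
    have h2 := X_pow_dvd_series_mul_sub (comm a b) hae
    have h3 := hγ.mul_left (C (coeff 1 (comm a b).series))
    have h4 : X ^ (m + k + 2) ∣ g.series - (comm a b).series -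
        C (coeff (m + k + 1) (g.series - (comm a b).series)) * X ^ (m + k + 1) := by
      rw [X_pow_dvd_iff]
      intro j hj
      rcases Nat.lt_succ_iff_lt_or_eq.mp hj with hj | rfl
      · rw [map_sub, coeff_C_mul, coeff_X_pow, if_neg hj.ne, mul_zero, sub_zero, map_sub,
          hg.coeff_eq hj, sub_self]
      · generalize g.series - (comm a b).series = p
        rw [map_sub, coeff_C_mul, coeff_X_pow, if_pos rfl, mul_one, sub_self]
    have hc : C (coeff 1 (comm a b).series) * C (coeff 1 (comm a b).series)⁻¹ =
        (1 : PowerSeries K) := by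
      rw [← map_mul, mul_inv_cancel₀ (comm a b).coeff_one_ne_zero, map_one]
    have h5 : Cong (m + k + 2) (comm a b * comm a e) g := by
      rw [Cong]
      convert dvd_sub (dvd_add h2 h3) h4 using 1
      rw [map_mul]
      linear_combination C (coeff (m + k + 1) (g.series - (comm a b).series)) *
        X ^ (m + k + 1) * hc
    have := h5.mul h1
    rwa [mul_one] at this

/-- Every series of depth `2 m + 1` is a commutator of two series of depth `m`. -/
theorem exists_comm_eq [CharZero K] (m : ℕ) {g : F1 K} (hg : g ∈ depth K (2 * m + 1)) :
    ∃ a ∈ depth K m, ∃ b ∈ depth K m, comm a b = g := by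
  obtain ⟨a, ha, H⟩ := exists_comm_leading (K := K) m
  choose! next hnext hcong hcomm using fun (b : F1 K) (hb : b ∈ depth K (m + 1)) (i : ℕ)
    (hi : Cong (m + (m + 1 + i) + 1) (comm a b) g) =>
      exists_comm_approx H hb (Nat.le_add_right _ _) hi
  let b : ℕ → F1 K := fun n => Nat.rec 1 (fun i c => next c i) n
  have hb : ∀ i, b i ∈ depth K (m + 1) ∧ Cong (m + (m + 1 + i) + 1) (comm a (b i)) g := by
    intro i
    induction i with
    | zero =>
      refine ⟨one_mem _, ?_⟩
      -- The start `b 0 = 1` works because `g` has depth `2 * m + 1`.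
      have h1 : comm a (b 0) = 1 := by
        change comm a 1 = 1
        rw [comm]
        group
      rw [h1]
      exact (Cong.mono (by omega) hg).symm
    | succ i ih => exact ⟨hnext _ ih.1 i ih.2, hcomm _ ih.1 i ih.2⟩
  obtain ⟨c, hc⟩ := exists_limit (b := b) fun i =>
    (hcong _ (hb i).1 i (hb i).2).mono (by omega)
  refine ⟨a, ha, c, ?_, Cong.eq_of_forall fun N => ?_⟩
  · have := (hc m).mono (Nat.le_succ _)
    exact this.trans (depth_anti (Nat.le_succ m) (hb m).1)
  · exact (((hc N).mono (by omega)).comm_right a).trans ((hb N).2.mono (by omega))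

/-! ### The derived series -/

open scoped commutatorElement in
-- The inverses reconcile `a⁻¹ b⁻¹ a b` with Mathlib's `a b a⁻¹ b⁻¹`; subgroups do not see the
-- difference.
theorem comm_eq_commutatorElement (a b : F1 K) : comm a b = ⁅a⁻¹, b⁻¹⁆ := by
  rw [comm, commutatorElement_def, inv_inv, inv_inv]

theorem commutator_depth [CharZero K] (m : ℕ) :
    ⁅depth K m, depth K m⁆ = depth K (2 * m + 1) := by
  apply le_antisymm
  · rw [Subgroup.commutator_le]
    intro a ha b hb
    have := comm_mem_depth_self m (inv_mem ha) (inv_mem hb)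
    rwa [comm_eq_commutatorElement, inv_inv, inv_inv] at this
  · intro g hg
    obtain ⟨a, ha, b, hb, rfl⟩ := exists_comm_eq m hg
    rw [comm_eq_commutatorElement]
    exact Subgroup.commutator_mem_commutator (inv_mem ha) (inv_mem hb)

theorem derivedSeries_eq_depth [CharZero K] (n : ℕ) :
    derivedSeries (F1 K) n = depth K (2 ^ n - 1) := by
  induction n with
  | zero => simp [depth_zero]
  | succ n ih =>
    rw [derivedSeries_succ, ih, commutator_depth]
    congr 1
    have := Nat.one_le_two_pow (n := n)
    rw [pow_succ]
    omega

theorem map_derivedSeries_J [CharZero K] (n : ℕ) :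
    (derivedSeries (J K) n).map (J K).subtype = derivedSeries (F1 K) (n + 1) := by
  induction n with
  | zero =>
    rw [derivedSeries_zero, ← MonoidHom.range_eq_map, Subgroup.range_subtype,
      derivedSeries_eq_depth, ← depth_one, zero_add, pow_one]
  | succ n ih => rw [derivedSeries_succ, Subgroup.map_commutator, ih, ← derivedSeries_succ]

end F1

theorem mainTheorem3 {K : Type*} [Field K] [CharZero K] (n : ℕ) (hn : 1 ≤ n) :
    derivedSeries (F1 K) n = (derivedSeries (F1.J K) (n - 1)).map (F1.J K).subtype ∧
    (derivedSeries (F1 K) n : Set (F1 K)) =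
      {g : F1 K | g ∈ F1.J K ∧ ∃ u : PowerSeries K, g.series = X + X ^ (2 ^ n) * u} ∧
    ∀ g ∈ derivedSeries (F1 K) n,
      ∃ a ∈ derivedSeries (F1 K) (n - 1), ∃ b ∈ derivedSeries (F1 K) (n - 1),
        g = a⁻¹ * b⁻¹ * a * b := by
  obtain ⟨n, rfl⟩ := Nat.exists_eq_add_of_le' hn
  refine ⟨(F1.map_derivedSeries_J n).symm, ?_, fun g hg => ?_⟩
  · ext g
    have h1 : 2 ^ (n + 1) - 1 + 1 = 2 ^ (n + 1) := Nat.sub_add_cancel Nat.one_le_two_pow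
    have h2 : 1 ≤ 2 ^ (n + 1) - 1 := by
      have := Nat.one_le_two_pow (n := n)
      rw [pow_succ]
      omega
    rw [SetLike.mem_coe, F1.derivedSeries_eq_depth, Set.mem_ofPred_eq, ← F1.depth_one]
    have h3 := F1.mem_depth_iff_exists (g := g) (N := 2 ^ (n + 1) - 1)
    rw [h1] at h3
    rw [← h3]
    exact ⟨fun h => ⟨F1.depth_anti h2 h, h⟩, fun h => h.2⟩
  · rw [Nat.add_sub_cancel]
    rw [derivedSeries_succ, F1.derivedSeries_eq_depth, F1.commutator_depth] at hg
    obtain ⟨a, ha, b, hb, h⟩ := F1.exists_comm_eq _ hg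
    rw [F1.derivedSeries_eq_depth]
    exact ⟨a, ha, b, hb, h.symm⟩
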